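/- Let $s\ge 2$ and let $d_1,\dots,d_s$ be integers with every $d_i>1$; put $d=\prod_{i=1}^s d_i$. For each prime $p$ let $h=\sum_{i=1}^s x_i^{d_i}\in A=(\mathbb{Z}/p)[x_1,\dots,x_s]$, and for $n\ge 0$ let $e_n(h)$ be the colength of the ideal $(h,x_1^{q},\dots,x_s^{q})$, $q=p^n$, that is, the length of the $A$-module $A/(h,x_1^{q},\dots,x_s^{q})$. Then for each prime $p$ the limit $\mu=\mu_p=\lim_{n\to\infty}e_n(h)/q^{s-1}$ (the Hilbert–Kunz multiplicity of $h$) exists, $\mu>0$, and $e_n(h)=\mu q^{s-1}+O(q^{s-2})$ as $n\to\infty$ with $p$ fixed; moreover $$\left|\frac{e_1(h)}{p^{s-1}}-\mu\right|\le\frac{ds}{p}.$$ Consequently, if $\lim_{p\to\infty}e_1(h)/p^{s-1}$ exists, where $p$ runs through the primes, then $\lim_{p\to\infty}\mu_p$ exists and $$\lim_{p\to\infty}\mu_p=\lim_{p\to\infty}\frac{e_1(h)}{p^{s-1}}.$$ -/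

import Mathlib

open Filter Topology Asymptotics

namespace HilbertKunz

/-- The ideal of `(ℤ/p)[x₁, …, x_s]` generated by `h` and the `x_i ^ q`, where `q = p ^ n`. -/
noncomputable def frobIdeal {p s : ℕ} (h : MvPolynomial (Fin s) (ZMod p)) (n : ℕ) :
    Ideal (MvPolynomial (Fin s) (ZMod p)) :=
  Ideal.span (insert h (Set.range fun i : Fin s => MvPolynomial.X i ^ p ^ n))

/-- The colength of an ideal `I` of `A`: the length of the `A`-module `A / I`. -/
noncomputable def colength {A : Type*} [CommRing A] (I : Ideal A) : ℕ∞ :=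
  Module.length A (A ⧸ I)

/-- For `p` prime the ideal generated by `h` and the `x_i ^ q` has finite colength, so that
nothing is lost by regarding its colength as a natural number. -/
theorem colength_frobIdeal_ne_top {p s : ℕ} (hp : p.Prime)
    (h : MvPolynomial (Fin s) (ZMod p)) (n : ℕ) : colength (frobIdeal h n) ≠ ⊤ := by
  have : Fact p.Prime := ⟨hp⟩
  set I := frobIdeal h n with hI
  have hint : ∀ i : Fin s, IsIntegral (ZMod p) (Ideal.Quotient.mkₐ (ZMod p) I (MvPolynomial.X i)) := by
    intro i
    refine IsIntegral.of_pow (n := p ^ n) (pow_pos hp.pos n) ?_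
    have h0 : (Ideal.Quotient.mkₐ (ZMod p) I (MvPolynomial.X i)) ^ p ^ n = 0 := by
      rw [← map_pow]
      exact Ideal.Quotient.eq_zero_iff_mem.mpr
        (Ideal.subset_span (Set.mem_insert_of_mem _ ⟨i, rfl⟩))
    rw [h0]
    exact isIntegral_zero
  have hfg := fg_adjoin_of_finite (R := ZMod p)
    (Set.finite_range fun i : Fin s => Ideal.Quotient.mkₐ (ZMod p) I (MvPolynomial.X i))
    (by rintro _ ⟨i, rfl⟩; exact hint i)
  have htop : Algebra.adjoin (ZMod p)
      (Set.range fun i : Fin s => Ideal.Quotient.mkₐ (ZMod p) I (MvPolynomial.X i)) = ⊤ := by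
    have h1 := AlgHom.map_adjoin (Ideal.Quotient.mkₐ (ZMod p) I)
      (Set.range (MvPolynomial.X : Fin s → MvPolynomial (Fin s) (ZMod p)))
    rw [MvPolynomial.adjoin_range_X, Algebra.map_top, ← Set.range_comp,
      (AlgHom.range_eq_top _).mpr (Ideal.Quotient.mkₐ_surjective _ _)] at h1
    exact h1.symm
  rw [htop] at hfg
  have : Module.Finite (ZMod p) (MvPolynomial (Fin s) (ZMod p) ⧸ I) := ⟨hfg⟩
  have : IsArtinian (MvPolynomial (Fin s) (ZMod p)) (MvPolynomial (Fin s) (ZMod p) ⧸ I) :=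
    isArtinian_of_tower (ZMod p) inferInstance
  exact Module.length_ne_top_iff.mpr
    (isFiniteLength_iff_isNoetherian_isArtinian.mpr ⟨inferInstance, inferInstance⟩)

/-- The Hilbert–Kunz function `e_n(h)`: the colength of the ideal generated by `h` and the
`x_i ^ q`, where `q = p ^ n`. -/
noncomputable def e {p s : ℕ} (n : ℕ) (h : MvPolynomial (Fin s) (ZMod p)) : ℕ :=
  (colength (frobIdeal h n)).toNat

/-- `μ` is a Hilbert–Kunz multiplicity of `h`: `μ > 0` and
`e_n(h) = μ q ^ (s - 1) + O(q ^ (s - 2))` as `n → ∞`, where `q = p ^ n`. It is used only for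
`s ≥ 2`; there is then at most one such `μ`. -/
def IsMultiplicity {p s : ℕ} (h : MvPolynomial (Fin s) (ZMod p)) (μ : ℝ) : Prop :=
  0 < μ ∧
    (fun n : ℕ => (e n h : ℝ) - μ * ((p : ℝ) ^ n) ^ (s - 1)) =O[atTop]
      (fun n : ℕ => ((p : ℝ) ^ n) ^ (s - 2))

/-- The Hilbert–Kunz multiplicity of `h`: the limit of `e_n(h) / q ^ (s - 1)` as `n → ∞`. -/
noncomputable def multiplicity {p s : ℕ} (h : MvPolynomial (Fin s) (ZMod p)) : ℝ :=
  limUnder atTop fun n : ℕ => (e n h : ℝ) / ((p : ℝ) ^ n) ^ (s - 1)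

/-- The element `∑ x_i ^ d_i` of `(ℤ/p)[x₁, …, x_s]`. -/
noncomputable def diagonal (p : ℕ) {s : ℕ} (d : Fin s → ℕ) : MvPolynomial (Fin s) (ZMod p) :=
  ∑ i, MvPolynomial.X i ^ d i

/-- `p → ∞` through the prime numbers. -/
def primesAtTop : Filter ℕ := atTop ⊓ 𝓟 {p : ℕ | p.Prime}

end HilbertKunz

/-! Let `L(b)` be the dimension over `ℤ/p` of the quotient by `∑ x_i` and the `x_i ^ b_i`. The
substitution `x_i ↦ x_i ^ d_i` makes the polynomial ring free of rank `d` over itself, so the ideal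
`(h, x_i ^ (d_i b_i))` has colength `d * L(b)` (`length_powIdeal_diagonal`). Rounding `q / d_i` down
and up therefore squeezes `e_n(h)` between `d * L(⌊q/d_i⌋)` and `d * L(⌊q/d_i⌋ + 1)`.

Eliminating a variable and applying Frobenius gives `L(p b) = p ^ (s-1) * L(b)`
(`linLength_prime_mul`). So after division by `q ^ (s-1)` the lower bounds increase with `n` and the
upper bounds decrease. Raising every exponent by one costs at most `s * q ^ (s-2)`
(`linLength_le_add_card_mul`), so the bounds differ by at most `d s / q`. Both `e_n / q ^ (s-1)` and
`μ` lie between them for every `n`; the case `n = 1` is uniform in `p` and compares the limits over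
primes. -/

namespace HilbertKunz

open MvPolynomial

/-! ### Colength as dimension over the ground field -/

section Colength

variable {k : Type*} [Field k] {σ : Type*}

/-- The difference of a polynomial and its constant term lies in every ideal that contains the
variables. -/
theorem sub_C_constantCoeff_mem {J : Ideal (MvPolynomial σ k)} (hJ : ∀ i, X i ∈ J)
    (f : MvPolynomial σ k) : f - C (constantCoeff f) ∈ J := by
  induction f using MvPolynomial.induction_on with
  | C a => simp
  | add f g hf hg =>
    convert J.add_mem hf hg using 1
    simp only [map_add]
    ring
  | mul_X f i _ => simpa using J.mul_mem_left f (hJ i)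

/-- If an ideal `I` contains a power of each variable, then the colength of `I` is the dimension
over the ground field of the quotient by `I`. -/
theorem colength_eq_length_base {I : Ideal (MvPolynomial σ k)} {N : ℕ} (hI : ∀ i, X i ^ N ∈ I) :
    colength I = Module.length k (MvPolynomial σ k ⧸ I) := by
  rcases subsingleton_or_nontrivial (MvPolynomial σ k ⧸ I) with h | h
  · simp [colength]
  -- The variables are nilpotent in the quotient, so modulo any maximal ideal every element equals
  -- its constant term. Hence the quotient is local with residue field `k`, and length over it
  -- agrees with length over `k`.
  have hX : ∀ m : Ideal (MvPolynomial σ k ⧸ I), m.IsMaximal → ∀ i, Ideal.Quotient.mk I (X i) ∈ m := by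
    intro m hm i
    refine hm.isPrime.mem_of_pow_mem N ?_
    rw [← map_pow, Ideal.Quotient.eq_zero_iff_mem.mpr (hI i)]
    exact m.zero_mem
  have hsub : ∀ m : Ideal (MvPolynomial σ k ⧸ I), m.IsMaximal → ∀ f : MvPolynomial σ k,
      Ideal.Quotient.mk I f - algebraMap k _ (constantCoeff f) ∈ m := by
    intro m hm f
    exact sub_C_constantCoeff_mem (J := m.comap (Ideal.Quotient.mk I)) (hX m hm) f
  have hle : ∀ m m' : Ideal (MvPolynomial σ k ⧸ I), m.IsMaximal → m'.IsMaximal → m ≤ m' := by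
    intro m m' hm hm' x hx
    obtain ⟨f, rfl⟩ := Ideal.Quotient.mk_surjective x
    have h1 := m.sub_mem hx (hsub m hm f)
    rw [sub_sub_cancel] at h1
    have h0 : constantCoeff f = 0 := by
      by_contra h0
      exact hm.ne_top (Ideal.eq_top_of_isUnit_mem _ h1 ((IsUnit.mk0 _ h0).map _))
    simpa [h0] using hsub m' hm' f
  obtain ⟨m, hm⟩ := Ideal.exists_maximal (MvPolynomial σ k ⧸ I)
  have : IsLocalRing (MvPolynomial σ k ⧸ I) :=
    IsLocalRing.of_unique_max_ideal ⟨m, hm, fun m' hm' => (hle m' m hm' hm).antisymm (hle m m' hm hm')⟩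
  have hsurj : Function.Surjective
      (algebraMap (IsLocalRing.ResidueField k) (IsLocalRing.ResidueField (MvPolynomial σ k ⧸ I))) := by
    intro x
    obtain ⟨y, rfl⟩ := IsLocalRing.residue_surjective x
    obtain ⟨f, rfl⟩ := Ideal.Quotient.mk_surjective y
    refine ⟨IsLocalRing.residue k (constantCoeff f), ?_⟩
    have := (Ideal.Quotient.eq.mpr
      (hsub _ (IsLocalRing.maximalIdeal.isMaximal (MvPolynomial σ k ⧸ I)) f)).symm
    exact this
  rw [IsLocalRing.length_restrictScalars k (MvPolynomial σ k ⧸ I) (MvPolynomial σ k ⧸ I),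
    Module.length_eq_of_surjective (M := IsLocalRing.ResidueField (MvPolynomial σ k ⧸ I)) hsurj,
    Module.length_eq_one (IsLocalRing.ResidueField (MvPolynomial σ k ⧸ I)), mul_one, colength]
  exact Module.length_eq_of_surjective Ideal.Quotient.mk_surjective

section Algebra

variable {A B : Type*} [CommRing A] [Algebra k A] [CommRing B] [Algebra k B]

theorem length_quotient_anti {I J : Ideal A} (h : I ≤ J) :
    Module.length k (A ⧸ J) ≤ Module.length k (A ⧸ I) :=
  Module.length_le_of_surjective (Ideal.Quotient.factorₐ k h).toLinearMap
    (Ideal.Quotient.factor_surjective h)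

/-- Multiplication by `f` gives an exact sequence `A / J₂ → A / I → A / J₁ → 0`. -/
theorem length_quotient_le_add {I J₁ J₂ : Ideal A} (f : A) (h₁ : J₁ ≤ I ⊔ Ideal.span {f})
    (h₂ : ∀ x ∈ J₂, f * x ∈ I) :
    Module.length k (A ⧸ I) ≤ Module.length k (A ⧸ J₁) + Module.length k (A ⧸ J₂) := by
  have hle : I ≤ I ⊔ Ideal.span {f} := le_sup_left
  set g := (Ideal.Quotient.factorₐ k hle).toLinearMap
  have hgs : Function.Surjective g := Ideal.Quotient.factor_surjective hle
  rw [Module.length_eq_add_of_exact (LinearMap.ker g).subtype g (Submodule.subtype_injective _) hgs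
    (LinearMap.exact_subtype_ker_map g), add_comm]
  refine add_le_add (length_quotient_anti h₁) ?_
  -- The kernel of `A / I → A / (I, f)` is generated by `f`, so multiplication by `f` maps onto it.
  let m : A ⧸ J₂ →ₗ[A] A ⧸ I := Submodule.mapQ J₂ I (LinearMap.mulLeft A f) h₂
  have hm : ∀ x : A ⧸ J₂, m x ∈ LinearMap.ker g := by
    intro x
    obtain ⟨x, rfl⟩ := Ideal.Quotient.mk_surjective x
    change Ideal.Quotient.mk (I ⊔ Ideal.span {f}) (f * x) = 0
    rw [Ideal.Quotient.eq_zero_iff_mem]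
    exact Ideal.mul_mem_right _ _ (Ideal.mem_sup_right (Ideal.mem_span_singleton_self f))
  refine Module.length_le_of_surjective ((m.restrictScalars k).codRestrict
    (LinearMap.ker g) hm) ?_
  rintro ⟨x, hx⟩
  obtain ⟨x, rfl⟩ := Ideal.Quotient.mk_surjective x
  have hx' : x ∈ I ⊔ Ideal.span {f} := Ideal.Quotient.eq_zero_iff_mem.mp hx
  obtain ⟨y, hy, z, hz, rfl⟩ := Submodule.mem_sup.mp hx'
  obtain ⟨w, rfl⟩ := Ideal.mem_span_singleton.mp hz
  refine ⟨Ideal.Quotient.mk J₂ w, Subtype.ext ?_⟩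
  change Ideal.Quotient.mk I (f * w) = Ideal.Quotient.mk I (y + f * w)
  rw [map_add, Ideal.Quotient.eq_zero_iff_mem.mpr hy, zero_add]

theorem length_quotient_map_of_surjective (θ : A →ₐ[k] B) (hθ : Function.Surjective θ)
    {I : Ideal A} (hI : RingHom.ker θ ≤ I) :
    Module.length k (A ⧸ I) = Module.length k (B ⧸ I.map θ) := by
  let g : A →ₐ[k] B ⧸ I.map θ := (Ideal.Quotient.mkₐ k (I.map θ)).comp θ
  have hg : Function.Surjective g := (Ideal.Quotient.mkₐ_surjective k _).comp hθ
  have hker : I = RingHom.ker g := by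
    ext x
    change x ∈ I ↔ Ideal.Quotient.mk (I.map θ) (θ x) = 0
    rw [Ideal.Quotient.eq_zero_iff_mem, ← Ideal.mem_comap, Ideal.comap_map_of_surjective θ hθ]
    exact ⟨Ideal.mem_sup_left, fun h => sup_le le_rfl hI h⟩
  exact ((Ideal.quotientEquivAlgOfEq k hker).trans
    (Ideal.quotientKerAlgEquivOfSurjective hg)).toLinearEquiv.length_eq

end Algebra

end Colength

/-! ### Freeness along `x_i ↦ x_i ^ m_i` -/

section PowSubst

variable {k : Type*} [Field k] {σ : Type*}

/-- The substitution `x_i ↦ x_i ^ m_i`. -/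
noncomputable def powSubst (k : Type*) [Field k] (m : σ → ℕ) :
    MvPolynomial σ k →ₐ[k] MvPolynomial σ k :=
  aeval fun i => X i ^ m i

@[simp]
theorem powSubst_X (m : σ → ℕ) (i : σ) : powSubst k m (X i) = X i ^ m i := by
  simp [powSubst]

variable [Fintype σ]

/-- Division with remainder of exponent vectors. -/
noncomputable def exponentEquiv (m : σ → ℕ) (hm : ∀ i, 0 < m i) :
    (Σ _ : (∀ i, Fin (m i)), σ →₀ ℕ) ≃ (σ →₀ ℕ) where
  toFun x := Finsupp.equivFunOnFinite.symm fun i => m i * x.2 i + x.1 i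
  invFun a := ⟨fun i => ⟨a i % m i, Nat.mod_lt _ (hm i)⟩,
    Finsupp.equivFunOnFinite.symm fun i => a i / m i⟩
  left_inv := by
    rintro ⟨r, a⟩
    have h1 : (fun i => (⟨(m i * a i + r i) % m i, Nat.mod_lt _ (hm i)⟩ : Fin (m i))) = r := by
      funext i
      ext
      simp [Nat.mod_eq_of_lt (r i).2]
    have h2 : (Finsupp.equivFunOnFinite.symm fun i => (m i * a i + r i) / m i) = a := by
      ext i
      simp [Nat.mul_add_div (hm i), Nat.div_eq_of_lt (r i).2]
    exact Sigma.ext h1 (heq_of_eq h2)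
  right_inv a := by
    ext i
    simp [Nat.div_add_mod]

theorem powSubst_monomial (m : σ → ℕ) (a : σ →₀ ℕ) :
    powSubst k m (monomial a 1) =
      monomial (Finsupp.equivFunOnFinite.symm fun i => m i * a i) 1 := by
  rw [monomial_eq, monomial_eq, Finsupp.prod_fintype _ _ (by simp),
    Finsupp.prod_fintype _ _ (by simp)]
  simp [pow_mul]

variable [DecidableEq σ]

/-- Along the substitution `x_i ↦ x_i ^ m_i` the polynomial ring is free over itself, with the
monomials of exponents `r_i < m_i` as a basis. -/
noncomputable def powSubstEquiv (k : Type*) [Field k] (m : σ → ℕ) (hm : ∀ i, 0 < m i) :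
    ((∀ i, Fin (m i)) → MvPolynomial σ k) ≃ₗ[k] MvPolynomial σ k :=
  (Pi.basis fun _ => basisMonomials σ k).equiv (basisMonomials σ k) (exponentEquiv m hm)

/-- The bijection of bases is only `k`-linear by construction; this formula shows that it is
semilinear along `powSubst`, which lets it match ideals. -/
theorem powSubstEquiv_apply (m : σ → ℕ) (hm : ∀ i, 0 < m i)
    (g : (∀ i, Fin (m i)) → MvPolynomial σ k) :
    powSubstEquiv k m hm g =
      ∑ r, powSubst k m (g r) * monomial (Finsupp.equivFunOnFinite.symm fun i => (r i : ℕ)) 1 := by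
  let Ψ : ((∀ i, Fin (m i)) → MvPolynomial σ k) →ₗ[k] MvPolynomial σ k :=
    ∑ r, (LinearMap.mulRight k (monomial (Finsupp.equivFunOnFinite.symm fun i => (r i : ℕ)) 1)) ∘ₗ
      (powSubst k m).toLinearMap ∘ₗ LinearMap.proj r
  have h : (powSubstEquiv k m hm).toLinearMap = Ψ := by
    refine (Pi.basis fun _ : (∀ i, Fin (m i)) => basisMonomials σ k).ext ?_
    rintro ⟨r, a⟩
    have h1 : powSubstEquiv k m hm ((Pi.basis fun _ => basisMonomials σ k) ⟨r, a⟩) =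
        monomial (exponentEquiv m hm ⟨r, a⟩) 1 := by
      rw [powSubstEquiv, Module.Basis.equiv_apply, coe_basisMonomials]
    have h2 : Ψ ((Pi.basis fun _ => basisMonomials σ k) ⟨r, a⟩) =
        powSubst k m (monomial a 1) *
          monomial (Finsupp.equivFunOnFinite.symm fun i => (r i : ℕ)) 1 := by
      simp only [Ψ, LinearMap.sum_apply, LinearMap.comp_apply, LinearMap.proj_apply,
        AlgHom.toLinearMap_apply, LinearMap.mulRight_apply, Pi.basis_apply, coe_basisMonomials]
      rw [Finset.sum_eq_single r]
      · simp
      · intro r' _ hr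
        simp [Pi.single_eq_of_ne hr]
      · simp
    rw [LinearEquiv.coe_coe, h1, h2, powSubst_monomial, monomial_mul, one_mul]
    refine congrArg (fun b => monomial b (1 : k)) ?_
    ext i
    simp [exponentEquiv]
  have h' := congrArg (fun Φ => Φ g) h
  simpa [Ψ] using h'

/-- The dimension of the quotient by an ideal is multiplied by `∏ m_i` under the substitution
`x_i ↦ x_i ^ m_i`. -/
theorem length_quotient_map_powSubst (m : σ → ℕ) (hm : ∀ i, 0 < m i)
    (I : Ideal (MvPolynomial σ k)) :
    Module.length k (MvPolynomial σ k ⧸ I.map (powSubst k m)) =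
      (∏ i, m i : ℕ) * Module.length k (MvPolynomial σ k ⧸ I) := by
  set P : Submodule k ((∀ i, Fin (m i)) → MvPolynomial σ k) :=
    Submodule.pi Set.univ fun _ => I.restrictScalars k
  have hmap : P.map (powSubstEquiv k m hm).toLinearMap =
      (I.map (powSubst k m)).restrictScalars k := by
    apply le_antisymm
    · rintro _ ⟨g, hg, rfl⟩
      rw [LinearEquiv.coe_coe, powSubstEquiv_apply]
      exact Ideal.sum_mem _ fun r _ => Ideal.mul_mem_right _ _
        (Ideal.mem_map_of_mem _ (hg r (Set.mem_univ r)))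
    · intro x hx
      refine Submodule.closure_induction (p := fun x _ =>
        x ∈ P.map (powSubstEquiv k m hm).toLinearMap) (Submodule.zero_mem _)
        (fun _ _ _ _ => Submodule.add_mem _) ?_ hx
      -- Expanding the multiplier `a` in the monomial basis puts every coordinate of the product in
      -- `I`.
      rintro a _ ⟨f, hf, rfl⟩
      obtain ⟨c, rfl⟩ := (powSubstEquiv k m hm).surjective a
      refine ⟨fun r => f * c r, fun r _ => I.mul_mem_right _ hf, ?_⟩
      rw [LinearEquiv.coe_coe, powSubstEquiv_apply, powSubstEquiv_apply, smul_eq_mul, mul_comm,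
        Finset.mul_sum]
      simp [mul_assoc]
  have h1 := (Submodule.Quotient.equiv P _ (powSubstEquiv k m hm) hmap).length_eq
  have h2 := (Submodule.quotientPi fun _ : (∀ i, Fin (m i)) => I.restrictScalars k).length_eq
  rw [Module.length_pi, ENat.card_eq_coe_fintype_card, Fintype.card_pi] at h2
  simp only [Fintype.card_fin] at h2
  exact (h1.symm.trans h2 :)

end PowSubst

/-! ### The ideal of `∑ x_i` and powers of the variables -/

section LinLength

variable {k : Type*} [Field k] {σ : Type*}

/-- The ideal generated by `h` and the `x_i ^ b_i`. -/
noncomputable def powIdeal (h : MvPolynomial σ k) (b : σ → ℕ) : Ideal (MvPolynomial σ k) :=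
  Ideal.span (insert h (Set.range fun i => X i ^ b i))

theorem self_mem_powIdeal (h : MvPolynomial σ k) (b : σ → ℕ) : h ∈ powIdeal h b :=
  Ideal.subset_span (Set.mem_insert _ _)

theorem X_pow_mem_powIdeal (h : MvPolynomial σ k) {b : σ → ℕ} {i : σ} {n : ℕ} (hn : b i ≤ n) :
    X i ^ n ∈ powIdeal h b :=
  Ideal.mem_of_dvd _ (pow_dvd_pow _ hn)
    (Ideal.subset_span (Set.mem_insert_of_mem _ ⟨i, rfl⟩))

theorem powIdeal_le_iff {h : MvPolynomial σ k} {b : σ → ℕ} {J : Ideal (MvPolynomial σ k)} :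
    powIdeal h b ≤ J ↔ h ∈ J ∧ ∀ i, X i ^ b i ∈ J := by
  rw [powIdeal, Ideal.span_le, Set.insert_subset_iff, Set.range_subset_iff]
  rfl

theorem powIdeal_anti (h : MvPolynomial σ k) {b c : σ → ℕ} (hbc : b ≤ c) :
    powIdeal h c ≤ powIdeal h b :=
  powIdeal_le_iff.mpr ⟨self_mem_powIdeal h b, fun i => X_pow_mem_powIdeal h (hbc i)⟩

theorem map_powIdeal {B F : Type*} [CommRing B] [FunLike F (MvPolynomial σ k) B]
    [RingHomClass F (MvPolynomial σ k) B] (f : F) (h : MvPolynomial σ k) (b : σ → ℕ) :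
    (powIdeal h b).map f = Ideal.span (insert (f h) (Set.range fun i => f (X i) ^ b i)) := by
  rw [powIdeal, Ideal.map_span, Set.image_insert_eq, ← Set.range_comp]
  simp [Function.comp_def]

variable [Fintype σ]

theorem powIdeal_map_powSubst (m b : σ → ℕ) :
    (powIdeal (∑ i, X i) b).map (powSubst k m) =
      powIdeal (∑ i, X i ^ m i) fun i => m i * b i := by
  rw [map_powIdeal, powIdeal]
  simp [pow_mul]

/-- The dimension of the quotient by the ideal generated by all `x_i ^ c_i`. -/
theorem length_quotient_span_X_pow (c : σ → ℕ) (hc : ∀ i, 0 < c i) :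
    Module.length k (MvPolynomial σ k ⧸
      Ideal.span (Set.range fun i => (X i ^ c i : MvPolynomial σ k))) = (∏ i, c i : ℕ) := by
  classical
  have hX : ∀ i, X i ∈ Ideal.span (Set.range (X : σ → MvPolynomial σ k)) :=
    fun i => Ideal.subset_span ⟨i, rfl⟩
  have h1 : Ideal.span (Set.range fun i => (X i ^ c i : MvPolynomial σ k)) =
      (Ideal.span (Set.range X)).map (powSubst k c) := by
    rw [Ideal.map_span, ← Set.range_comp]
    simp [Function.comp_def]
  let θ : MvPolynomial σ k →ₐ[k] k := aeval fun _ => 0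
  have hθ : ∀ f, θ f = constantCoeff f := fun f => by
    simp [θ, constantCoeff_eq, aeval_zero']
  have h2 : Module.length k (MvPolynomial σ k ⧸ Ideal.span (Set.range (X : σ → MvPolynomial σ k)))
      = 1 := by
    rw [length_quotient_map_of_surjective θ (fun a => ⟨C a, by simp [hθ]⟩)]
    · have : (Ideal.span (Set.range (X : σ → MvPolynomial σ k))).map θ = ⊥ := by
        rw [Ideal.map_span, ← Set.range_comp, Ideal.span_eq_bot]
        rintro _ ⟨i, rfl⟩
        simp [θ]
      rw [this, (Submodule.quotEquivOfEqBot (⊥ : Ideal k) rfl).length_eq]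
      exact Module.length_eq_one k k
    · intro f hf
      have h := sub_C_constantCoeff_mem hX f
      rwa [← hθ, RingHom.mem_ker.mp hf, map_zero, sub_zero] at h
  rw [h1, length_quotient_map_powSubst c hc, h2, mul_one]

/-- The dimension of `k[x] / (∑ x_i, x_i ^ b_i)`. -/
noncomputable def linLength (k : Type*) [Field k] (b : σ → ℕ) : ℕ∞ :=
  Module.length k (MvPolynomial σ k ⧸ powIdeal (∑ i, X i) b)

theorem linLength_mono {b c : σ → ℕ} (h : b ≤ c) : linLength k b ≤ linLength k c :=
  length_quotient_anti (powIdeal_anti _ h)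

theorem linLength_pos {b : σ → ℕ} (hb : ∀ i, 0 < b i) : 0 < linLength k b := by
  have : Nontrivial (MvPolynomial σ k ⧸ powIdeal (∑ i, X i : MvPolynomial σ k) b) := by
    refine Ideal.Quotient.nontrivial_iff.mpr (ne_top_of_le_ne_top
      (RingHom.ker_ne_top (constantCoeff (σ := σ) (R := k))) (powIdeal_le_iff.mpr ⟨?_, ?_⟩))
    · simp [RingHom.mem_ker]
    · intro i
      simp [RingHom.mem_ker, (hb i).ne']
  exact Module.length_pos

variable [DecidableEq σ]

/-- The projection of the polynomial ring onto the polynomial ring in the variables other than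
`x_l` that takes the sum of the variables to `0`. -/
noncomputable def elim (k : Type*) [Field k] (l : σ) :
    MvPolynomial σ k →ₐ[k] MvPolynomial {j // j ≠ l} k :=
  aeval fun j => if h : j ≠ l then X ⟨j, h⟩ else -∑ i, X i

theorem elim_X {l j : σ} (h : j ≠ l) : elim k l (X j) = X ⟨j, h⟩ := by
  simp [elim, h]

theorem elim_X_self (l : σ) : elim k l (X l) = -∑ i, X i := by
  simp [elim]

theorem elim_sum (l : σ) : elim k l (∑ i, X i) = 0 := by
  rw [map_sum, ← Finset.add_sum_erase _ _ (Finset.mem_univ l), elim_X_self, neg_add_eq_zero]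
  rw [Finset.sum_subtype (Finset.univ.erase l) (p := fun j => j ≠ l) (by simp)]
  exact Finset.sum_congr rfl fun j _ => (elim_X j.2).symm

theorem elim_rename (l : σ) (f : MvPolynomial {j // j ≠ l} k) :
    elim k l (rename Subtype.val f) = f := by
  have : (elim k l).comp (rename Subtype.val) = AlgHom.id k _ := by
    ext j
    simp [elim_X j.2]
  exact congrArg (fun φ => φ f) this

theorem elim_surjective (l : σ) : Function.Surjective (elim k l) :=
  fun f => ⟨_, elim_rename l f⟩

/-- Modulo `∑ x_i` the variable `x_l` is minus the sum of the others, so `elim` followed by the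
inclusion is the identity modulo `I`. -/
theorem ker_elim_le (l : σ) {I : Ideal (MvPolynomial σ k)} (hI : ∑ i, X i ∈ I) :
    RingHom.ker (elim k l) ≤ I := by
  have : (Ideal.Quotient.mkₐ k I).comp ((rename Subtype.val).comp (elim k l)) =
      Ideal.Quotient.mkₐ k I := by
    ext j
    by_cases h : j = l
    · subst h
      have h1 : ∑ i, (X i : MvPolynomial σ k) = X j + ∑ i : {i // i ≠ j}, X i.1 := by
        rw [← Finset.add_sum_erase _ _ (Finset.mem_univ j),
          Finset.sum_subtype (Finset.univ.erase j) (p := fun i => i ≠ j) (by simp)]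
      simp only [AlgHom.comp_apply, elim_X_self, map_neg, map_sum, rename_X]
      rw [← map_sum, neg_eq_iff_add_eq_zero, ← map_add, add_comm, ← h1]
      exact Ideal.Quotient.eq_zero_iff_mem.mpr hI
    · simp [elim_X h]
  intro f hf
  have h := congrArg (fun φ => φ f) this
  simp only [AlgHom.comp_apply, RingHom.mem_ker.mp hf, map_zero] at h
  exact Ideal.Quotient.eq_zero_iff_mem.mp h.symm

theorem linLength_eq_elim (l : σ) (b : σ → ℕ) :
    linLength k b = Module.length k (MvPolynomial {j // j ≠ l} k ⧸
      Ideal.span (insert 0 (Set.range fun i => elim k l (X i) ^ b i))) := by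
  rw [linLength, length_quotient_map_of_surjective (elim k l) (elim_surjective l)
    (ker_elim_le l (self_mem_powIdeal _ b)), map_powIdeal, elim_sum]

/-- The dimension of `k[x] / (∑ x_i, x_i ^ b_i)` is at most the product of all `b_i` but one. -/
theorem linLength_le_prod (l : σ) (b : σ → ℕ) (hb : ∀ i, 0 < b i) :
    linLength k b ≤ (∏ i : {j // j ≠ l}, b i : ℕ) := by
  rw [linLength_eq_elim l, ← length_quotient_span_X_pow (k := k) _ fun i => hb _]
  refine length_quotient_anti (Ideal.span_mono ?_)
  rintro _ ⟨i, rfl⟩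
  exact Set.mem_insert_of_mem _ ⟨i.1, by simp [elim_X i.2]⟩

/-- Raising one exponent by one raises the dimension by at most `q ^ (s - 2)`. -/
theorem linLength_le_add {b c : σ → ℕ} {q : ℕ} (hσ : 2 ≤ Fintype.card σ) (hq : 0 < q) (i : σ)
    (hbc : ∀ j, j ≠ i → c j = b j) (hi : c i ≤ b i + 1) (hc : ∀ j, c j ≤ q) :
    linLength k c ≤ linLength k b + (q ^ (Fintype.card σ - 2) : ℕ) := by
  -- Multiplication by `x_i ^ b_i` sends `x_i` and the other `x_j ^ q` into the ideal for `c`, so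
  -- `m` bounds the increase.
  let m : σ → ℕ := fun j => if j = i then 1 else q
  have h1 : linLength k c ≤ linLength k b + linLength k m := by
    refine length_quotient_le_add (X i ^ b i) (powIdeal_le_iff.mpr ⟨?_, fun j => ?_⟩) ?_
    · exact Ideal.mem_sup_left (self_mem_powIdeal _ _)
    · by_cases h : j = i
      · subst h
        exact Ideal.mem_sup_right (Ideal.mem_span_singleton_self _)
      · exact Ideal.mem_sup_left (X_pow_mem_powIdeal _ (hbc j h).le)
    · change powIdeal _ m ≤ Submodule.comap (LinearMap.mulLeft (MvPolynomial σ k) (X i ^ b i))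
        (powIdeal _ c)
      refine powIdeal_le_iff.mpr ⟨?_, fun j => ?_⟩
      · exact Ideal.mul_mem_left _ _ (self_mem_powIdeal _ _)
      · by_cases h : j = i
        · subst h
          simpa [m, ← pow_succ] using X_pow_mem_powIdeal (k := k) _ hi
        · exact Ideal.mul_mem_left _ _ (X_pow_mem_powIdeal _ (by simpa [m, h] using hc j))
  refine h1.trans (add_le_add_right ?_ _)
  have : Nontrivial σ := Fintype.one_lt_card_iff_nontrivial.mp hσ
  -- Omitting some `l ≠ i` keeps the factor `1` at `i`, leaving `s - 2` factors `q`.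
  obtain ⟨l, hl⟩ := exists_ne i
  refine (linLength_le_prod l m fun j => ?_).trans (le_of_eq ?_)
  · by_cases h : j = i <;> simp [m, h, hq]
  · congr 1
    have h2 : ∏ j : {j // j ≠ l}, m j = ∏ j ∈ Finset.univ.erase l, m j :=
      (Finset.prod_subtype _ (by simp) _).symm
    rw [h2, ← Finset.mul_prod_erase _ _ (Finset.mem_erase.mpr ⟨hl.symm, Finset.mem_univ i⟩)]
    rw [Finset.prod_congr rfl (g := fun _ => q)
      fun j hj => by simp [m, (Finset.mem_erase.mp hj).1]]
    rw [Finset.prod_const, Finset.card_erase_of_mem (by simp [hl.symm]),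
      Finset.card_erase_of_mem (Finset.mem_univ l), Finset.card_univ, Nat.sub_sub]
    simp [m]

theorem linLength_le_add_card_mul {b c : σ → ℕ} {q : ℕ} (hσ : 2 ≤ Fintype.card σ) (hq : 0 < q)
    (hbc : ∀ j, c j ≤ b j + 1) (hb : ∀ j, b j ≤ q) (hc : ∀ j, c j ≤ q) :
    linLength k c ≤ linLength k b + (Fintype.card σ * q ^ (Fintype.card σ - 2) : ℕ) := by
  -- The exponents are changed one at a time; `S` holds those already changed.
  have h : ∀ S : Finset σ, linLength k (fun j => if j ∈ S then c j else b j) ≤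
      linLength k b + (S.card * q ^ (Fintype.card σ - 2) : ℕ) := by
    intro S
    induction S using Finset.induction_on with
    | empty => simp
    | insert i S hi ih =>
      refine (linLength_le_add (b := fun j => if j ∈ S then c j else b j) hσ hq i ?_ ?_ ?_).trans
        ((add_le_add_left ih _).trans (le_of_eq ?_))
      · intro j hj
        simp [hj]
      · simp [hi, hbc i]
      · intro j
        split_ifs
        · exact hc j
        · exact hb j
      · rw [Finset.card_insert_of_notMem hi, add_mul, one_mul, Nat.cast_add, add_assoc]
  simpa using h Finset.univ

/-- Over `ℤ/p` the substitution `x_i ↦ x_i ^ p` is the Frobenius endomorphism. -/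
theorem powSubst_prime {p : ℕ} [Fact p.Prime] {τ : Type*} (f : MvPolynomial τ (ZMod p)) :
    powSubst (ZMod p) (fun _ => p) f = f ^ p :=
  expand_zmod f

/-- Frobenius would also raise the generator `∑ x_i` to the `p`-th power. Eliminating a variable
turns that generator into `0` and leaves `s - 1` variables, whence the exponent. -/
theorem linLength_prime_mul {p : ℕ} [Fact p.Prime] (hσ : 0 < Fintype.card σ) (b : σ → ℕ) :
    linLength (ZMod p) (fun i => p * b i) =
      (p ^ (Fintype.card σ - 1) : ℕ) * linLength (ZMod p) b := by
  obtain ⟨l⟩ := Fintype.card_pos_iff.mp hσ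
  have h := length_quotient_map_powSubst (k := ZMod p) (fun _ : {j // j ≠ l} => p)
    (fun _ => (Fact.out : p.Prime).pos)
    (Ideal.span (insert 0 (Set.range fun i => elim (ZMod p) l (X i) ^ b i)))
  have hpow : (powSubst (ZMod p) fun _ : {j // j ≠ l} => p) ∘
      (fun i => elim (ZMod p) l (X i) ^ b i) = fun i => elim (ZMod p) l (X i) ^ (p * b i) := by
    funext i
    rw [Function.comp_apply, powSubst_prime, ← pow_mul, mul_comm]
  rw [← linLength_eq_elim, Ideal.map_span, Set.image_insert_eq, ← Set.range_comp, map_zero, hpow,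
    ← linLength_eq_elim, Finset.prod_const, Finset.card_univ, Fintype.card_subtype_compl,
    Fintype.card_subtype_eq] at h
  exact h

end LinLength

/-! ### Convergence and its rate -/

section Squeeze

/-- A sequence squeezed between an increasing and a decreasing one, after division by the powers
of `P`, converges with the rate given by the distance of the two. -/
theorem exists_limit_of_squeeze {P C : ℝ} (hP : 1 < P) {r : ℕ} {a lo up : ℕ → ℝ}
    (hlo : ∀ n, lo n ≤ a n) (hup : ∀ n, a n ≤ up n)
    (hlo' : ∀ n, P ^ (r + 1) * lo n ≤ lo (n + 1)) (hup' : ∀ n, up (n + 1) ≤ P ^ (r + 1) * up n)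
    (hdiff : ∀ n, up n ≤ lo n + C * (P ^ n) ^ r) (hpos : ∃ n, 0 < lo n) :
    ∃ μ : ℝ, 0 < μ ∧ ∀ n, |a n / (P ^ n) ^ (r + 1) - μ| ≤ C / P ^ n := by
  have hP0 : 0 < P := zero_lt_one.trans hP
  have hQ : ∀ n : ℕ, 0 < (P ^ n) ^ (r + 1) := fun n => by positivity
  have hsucc : ∀ n : ℕ, (P ^ (n + 1)) ^ (r + 1) = P ^ (r + 1) * (P ^ n) ^ (r + 1) := fun n => by
    rw [pow_succ P n, mul_pow, mul_comm]
  let l : ℕ → ℝ := fun n => lo n / (P ^ n) ^ (r + 1)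
  let u : ℕ → ℝ := fun n => up n / (P ^ n) ^ (r + 1)
  have hl : Monotone l := monotone_nat_of_le_succ fun n => by
    simp only [l]
    rw [div_le_div_iff₀ (hQ n) (hQ _), hsucc]
    nlinarith [mul_le_mul_of_nonneg_right (hlo' n) (hQ n).le]
  have hu : Antitone u := antitone_nat_of_succ_le fun n => by
    simp only [u]
    rw [div_le_div_iff₀ (hQ _) (hQ n), hsucc]
    nlinarith [mul_le_mul_of_nonneg_right (hup' n) (hQ n).le]
  have hlu : ∀ m n, l m ≤ u n := fun m n =>
    (hl (le_max_left m n)).trans ((div_le_div_of_nonneg_right ((hlo _).trans (hup _)) (hQ _).le).trans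
      (hu (le_max_right m n)))
  have hbdd : BddAbove (Set.range l) := ⟨u 0, by rintro _ ⟨m, rfl⟩; exact hlu m 0⟩
  have h1 : ∀ n, l n ≤ ⨆ m, l m := fun n => le_ciSup hbdd n
  have h2 : ∀ n, ⨆ m, l m ≤ u n := fun n => ciSup_le fun m => hlu m n
  refine ⟨⨆ m, l m, ?_, fun n => ?_⟩
  · obtain ⟨n, hn⟩ := hpos
    exact (div_pos hn (hQ n)).trans_le (h1 n)
  · have h3 : u n - l n ≤ C / P ^ n := by
      simp only [u, l]
      rw [← sub_div, div_le_div_iff₀ (hQ n) (by positivity), pow_succ, ← mul_assoc]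
      exact mul_le_mul_of_nonneg_right (by linarith [hdiff n]) (by positivity)
    have h4 : l n ≤ a n / (P ^ n) ^ (r + 1) := div_le_div_of_nonneg_right (hlo n) (hQ n).le
    have h5 : a n / (P ^ n) ^ (r + 1) ≤ u n := div_le_div_of_nonneg_right (hup n) (hQ n).le
    rw [abs_le]
    constructor <;> linarith [h1 n, h2 n]

variable {s : ℕ}

theorem linLength_ne_top {k σ : Type*} [Field k] [Fintype σ] [Nonempty σ] (b : σ → ℕ) :
    linLength k b ≠ ⊤ := by
  classical
  -- Exponents are raised by one because the product bound needs them positive.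
  exact ne_top_of_le_ne_top (ENat.natCast_ne_top _) ((linLength_mono fun i => Nat.le_succ (b i)).trans
    (linLength_le_prod (Classical.arbitrary σ) _ fun i => Nat.succ_pos _))

theorem coe_e_eq {p : ℕ} [Fact p.Prime] (n : ℕ) (h : MvPolynomial (Fin s) (ZMod p)) :
    (e n h : ℕ∞) = Module.length (ZMod p)
      (MvPolynomial (Fin s) (ZMod p) ⧸ powIdeal h fun _ => p ^ n) := by
  rw [e, ENat.natCast_toNat (colength_frobIdeal_ne_top Fact.out h n)]
  exact colength_eq_length_base (N := p ^ n) fun i => X_pow_mem_powIdeal h le_rfl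

theorem length_powIdeal_diagonal {p : ℕ} {d : Fin s → ℕ} [Fact p.Prime] (hd : ∀ i, 0 < d i)
    (b : Fin s → ℕ) :
    Module.length (ZMod p) (MvPolynomial (Fin s) (ZMod p) ⧸
      powIdeal (diagonal p d) fun i => d i * b i) = (∏ i, d i : ℕ) * linLength (ZMod p) b := by
  rw [linLength, ← length_quotient_map_powSubst d hd, powIdeal_map_powSubst, diagonal]

/-- The distance of `e_n / q ^ (s - 1)` and its limit is at most `d s / q`. -/
theorem exists_multiplicity {p : ℕ} (hp : p.Prime) (hs : 2 ≤ s) {d : Fin s → ℕ}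
    (hd : ∀ i, 1 < d i) :
    ∃ μ : ℝ, 0 < μ ∧ ∀ n, |(e n (diagonal p d) : ℝ) / ((p : ℝ) ^ n) ^ (s - 1) - μ| ≤
      ((∏ i, d i : ℕ) : ℝ) * s / (p : ℝ) ^ n := by
  have : Fact p.Prime := ⟨hp⟩
  have : NeZero s := ⟨by omega⟩
  have hd0 : ∀ i, 0 < d i := fun i => zero_lt_one.trans (hd i)
  obtain ⟨r, rfl⟩ : ∃ r, s = r + 2 := ⟨s - 2, by omega⟩
  let lo : ℕ → ℕ := fun n => (linLength (ZMod p) fun i => p ^ n / d i).toNat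
  let up : ℕ → ℕ := fun n => (linLength (ZMod p) fun i => p ^ n / d i + 1).toNat
  have hlo : ∀ n, (lo n : ℕ∞) = linLength (ZMod p) fun i => p ^ n / d i :=
    fun n => ENat.natCast_toNat (linLength_ne_top _)
  have hup : ∀ n, (up n : ℕ∞) = linLength (ZMod p) fun i => p ^ n / d i + 1 :=
    fun n => ENat.natCast_toNat (linLength_ne_top _)
  have hloe : ∀ n, (∏ i, d i) * lo n ≤ e n (diagonal p d) := fun n => by
    rw [← ENat.natCast_le_natCast, Nat.cast_mul, hlo, coe_e_eq, ← length_powIdeal_diagonal hd0]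
    exact length_quotient_anti (powIdeal_anti _ fun i => Nat.mul_div_le _ _)
  have hupe : ∀ n, e n (diagonal p d) ≤ (∏ i, d i) * up n := fun n => by
    rw [← ENat.natCast_le_natCast, Nat.cast_mul, hup, coe_e_eq, ← length_powIdeal_diagonal hd0]
    exact length_quotient_anti (powIdeal_anti _ fun i => (Nat.lt_mul_div_succ _ (hd0 i)).le)
  have hcard : Fintype.card (Fin (r + 2)) = r + 2 := Fintype.card_fin _
  have hlo' : ∀ n, p ^ (r + 1) * lo n ≤ lo (n + 1) := fun n => by
    have h := linLength_prime_mul (p := p) (by omega) fun i => p ^ n / d i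
    rw [hcard, Nat.add_sub_assoc (by omega)] at h
    rw [← ENat.natCast_le_natCast, Nat.cast_mul, hlo, hlo, ← h]
    refine linLength_mono fun i => ?_
    rw [pow_succ']
    exact Nat.mul_div_le_mul_div_assoc _ _ _
  have hup' : ∀ n, up (n + 1) ≤ p ^ (r + 1) * up n := fun n => by
    have h := linLength_prime_mul (p := p) (by omega) fun i => p ^ n / d i + 1
    rw [hcard, Nat.add_sub_assoc (by omega)] at h
    rw [← ENat.natCast_le_natCast, Nat.cast_mul, hup, hup, ← h]
    refine linLength_mono fun i => ?_
    refine Nat.succ_le_of_lt ((Nat.div_lt_iff_lt_mul (hd0 i)).mpr ?_)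
    rw [pow_succ', mul_assoc, mul_comm _ (d i)]
    exact Nat.mul_lt_mul_of_pos_left (Nat.lt_mul_div_succ _ (hd0 i)) hp.pos
  have hdiff : ∀ n, up n ≤ lo n + (r + 2) * (p ^ n) ^ r := fun n => by
    have hq : 0 < p ^ n := pow_pos hp.pos n
    -- Here `d_i > 1` is essential: even the exponents rounded up stay at most `q`.
    have hlt : ∀ i, p ^ n / d i < p ^ n := fun i => Nat.div_lt_self hq (hd i)
    rw [← ENat.natCast_le_natCast, Nat.cast_add, hlo, hup]
    have h := linLength_le_add_card_mul (k := ZMod p) (b := fun i => p ^ n / d i)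
      (c := fun i => p ^ n / d i + 1) (by omega) hq (fun _ => le_rfl) (fun i => (hlt i).le) hlt
    rwa [hcard, Nat.add_sub_cancel] at h
  have hpos : ∃ n, 0 < lo n := by
    -- With this `n`, `p ^ n > n ≥ d_i` for all `i`, so no floor vanishes.
    refine ⟨∑ i, d i, ?_⟩
    rw [← ENat.natCast_lt_natCast, hlo]
    refine linLength_pos fun i => Nat.div_pos ?_ (hd0 i)
    exact (Finset.single_le_sum (fun j _ => Nat.zero_le (d j)) (Finset.mem_univ i)).trans
      (Nat.lt_pow_self hp.one_lt).le
  have hD : (0 : ℝ) < (∏ i, d i : ℕ) := by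
    exact_mod_cast Finset.prod_pos fun i _ => hd0 i
  refine exists_limit_of_squeeze (P := p) (r := r) (lo := fun n => ((∏ i, d i : ℕ) : ℝ) * lo n)
    (up := fun n => ((∏ i, d i : ℕ) : ℝ) * up n) (by exact_mod_cast hp.one_lt)
    (fun n => by exact_mod_cast hloe n) (fun n => by exact_mod_cast hupe n) (fun n => ?_)
    (fun n => ?_) (fun n => ?_) ?_
  · rw [mul_left_comm]
    exact mul_le_mul_of_nonneg_left (by exact_mod_cast hlo' n) hD.le
  · rw [mul_left_comm]
    exact mul_le_mul_of_nonneg_left (by exact_mod_cast hup' n) hD.le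
  · rw [mul_assoc, ← mul_add]
    exact mul_le_mul_of_nonneg_left (by exact_mod_cast hdiff n) hD.le
  · obtain ⟨n, hn⟩ := hpos
    exact ⟨n, mul_pos hD (by exact_mod_cast hn)⟩

theorem tendsto_const_div_pow {p : ℕ} (hp : p.Prime) (c : ℝ) :
    Tendsto (fun n : ℕ => c / (p : ℝ) ^ n) atTop (𝓝 0) :=
  tendsto_const_nhds.div_atTop (tendsto_pow_atTop_atTop_of_one_lt (by exact_mod_cast hp.one_lt))

theorem multiplicity_diagonal {p : ℕ} (hp : p.Prime) (hs : 2 ≤ s) {d : Fin s → ℕ}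
    (hd : ∀ i, 1 < d i) :
    0 < multiplicity (diagonal p d) ∧ ∀ n, |(e n (diagonal p d) : ℝ) / ((p : ℝ) ^ n) ^ (s - 1) -
      multiplicity (diagonal p d)| ≤ ((∏ i, d i : ℕ) : ℝ) * s / (p : ℝ) ^ n := by
  obtain ⟨μ, hμ, h⟩ := exists_multiplicity hp hs hd
  have hlim : Tendsto (fun n : ℕ => (e n (diagonal p d) : ℝ) / ((p : ℝ) ^ n) ^ (s - 1)) atTop
      (𝓝 μ) :=
    tendsto_iff_dist_tendsto_zero.mpr
      (squeeze_zero (fun _ => dist_nonneg) h (tendsto_const_div_pow hp _))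
  rw [multiplicity, hlim.limUnder_eq]
  exact ⟨hμ, h⟩

theorem isMultiplicity_diagonal {p : ℕ} (hp : p.Prime) (hs : 2 ≤ s) {d : Fin s → ℕ}
    (hd : ∀ i, 1 < d i) :
    IsMultiplicity (diagonal p d) (multiplicity (diagonal p d)) := by
  obtain ⟨hμ, h⟩ := multiplicity_diagonal hp hs hd
  refine ⟨hμ, IsBigO.of_bound (((∏ i, d i : ℕ) : ℝ) * s) (Eventually.of_forall fun n => ?_)⟩
  have hq : (0 : ℝ) < (p : ℝ) ^ n := pow_pos (by exact_mod_cast hp.pos) n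
  have hpow : ((p : ℝ) ^ n) ^ (s - 1) = ((p : ℝ) ^ n) ^ (s - 2) * (p : ℝ) ^ n := by
    rw [← pow_succ]
    congr 1
    omega
  have h1 := mul_le_mul_of_nonneg_right (h n) (pow_pos hq (s - 1)).le
  rw [← abs_of_pos (pow_pos hq (s - 1)), ← abs_mul, abs_of_pos (pow_pos hq (s - 1)), sub_mul,
    div_mul_cancel₀ _ (pow_pos hq (s - 1)).ne'] at h1
  rw [Real.norm_eq_abs, Real.norm_of_nonneg (pow_pos hq (s - 2)).le]
  refine h1.trans (le_of_eq ?_)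
  rw [hpow]
  field_simp

end Squeeze

end HilbertKunz

theorem theorem1p4 (s : ℕ) (hs : 2 ≤ s) (d : Fin s → ℕ) (hd : ∀ i, 1 < d i) :
    (∀ p : ℕ, p.Prime →
      HilbertKunz.IsMultiplicity (HilbertKunz.diagonal p d)
        (HilbertKunz.multiplicity (HilbertKunz.diagonal p d)) ∧
      |(HilbertKunz.e 1 (HilbertKunz.diagonal p d) : ℝ) / (p : ℝ) ^ (s - 1) -
        HilbertKunz.multiplicity (HilbertKunz.diagonal p d)| ≤
          ((∏ i, d i : ℕ) : ℝ) * (s : ℝ) / (p : ℝ)) ∧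
    ∀ L : ℝ,
      Tendsto (fun p : ℕ =>
          (HilbertKunz.e 1 (HilbertKunz.diagonal p d) : ℝ) / (p : ℝ) ^ (s - 1))
        HilbertKunz.primesAtTop (𝓝 L) →
      Tendsto (fun p : ℕ => HilbertKunz.multiplicity (HilbertKunz.diagonal p d))
        HilbertKunz.primesAtTop (𝓝 L) := by
  have hbound : ∀ p : ℕ, p.Prime →
      |(HilbertKunz.e 1 (HilbertKunz.diagonal p d) : ℝ) / (p : ℝ) ^ (s - 1) -
        HilbertKunz.multiplicity (HilbertKunz.diagonal p d)| ≤
          ((∏ i, d i : ℕ) : ℝ) * (s : ℝ) / (p : ℝ) := fun p hp => by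
    simpa using (HilbertKunz.multiplicity_diagonal hp hs hd).2 1
  refine ⟨fun p hp => ⟨HilbertKunz.isMultiplicity_diagonal hp hs hd, hbound p hp⟩, fun L hL => ?_⟩
  have h0 : Tendsto (fun p : ℕ => ((∏ i, d i : ℕ) : ℝ) * (s : ℝ) / (p : ℝ))
      HilbertKunz.primesAtTop (𝓝 0) :=
    -- The numerator `d s` does not depend on `p`.
    (tendsto_const_div_atTop_nhds_zero_nat _).mono_left inf_le_left
  have h1 : Tendsto (fun p : ℕ =>
      (HilbertKunz.e 1 (HilbertKunz.diagonal p d) : ℝ) / (p : ℝ) ^ (s - 1) -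
        HilbertKunz.multiplicity (HilbertKunz.diagonal p d)) HilbertKunz.primesAtTop (𝓝 0) :=
    squeeze_zero_norm' (eventually_inf_principal.mpr (Eventually.of_forall hbound)) h0
  simpa using hL.sub h1
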